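/- Let $G=(V,E)$ be a finite simple 2-regular graph with $n=|V|\ge 1$ vertices and girth at least $7$ ($G$ need not be connected). Put one qubit on each vertex, and for $S\subseteq V$ let $Z_S$ be the operator on $(\mathbb C^2)^{\otimes V}$ that acts as the Pauli matrix $Z$ on the qubits in $S$ and as the identity on the others; $X_v$ is the Pauli matrix $X$ on the qubit $v$. For a vertex $v$ with neighbours $v_1,v_2$ let $$H_v=\tfrac34 I-\tfrac14 Z_{\{v,v_1\}}-\tfrac14 Z_{\{v,v_2\}}-\tfrac14 Z_{\{v_1,v_2\}},$$ and let $H_2=\sum_{v\in V}H_v$ be the LocalMaxCut Hamiltonian, whose diagonal entry at $x\in\{0,1\}^V$ is the number of vertices at least half of whose incident edges are cut by $x$. Let $H_M=\sum_{v\in V}X_v$, let $|s\rangle=2^{-n/2}\sum_{z\in\{0,1\}^V}|z\rangle$, let $$|\gamma,\beta\rangle=e^{-i\beta H_M}e^{-i\gamma H_2}|s\rangle$$ be the one-round QAOA state, and let $F(\gamma,\beta)=\langle\gamma,\beta|H_2|\gamma,\beta\rangle$. Then: 1. For all real $\gamma,\beta$, $$F(\gamma,\beta)=\frac{3n}{4}+\frac{n}{32}\sin(4\beta)\bigl(3\sin\gamma+4\sin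 2\gamma+3\sin 3\gamma\bigr)-\frac{n}{16}\sin^2(2\beta)\,\sin\gamma\,\cos^2\!\left(\frac{\gamma}{2}\right)\bigl(\sin\gamma+4\sin 2\gamma+\sin 3\gamma\bigr).$$ 2. For all real $\gamma,\beta$, $F(\gamma,\beta)<0.94\,n$. 3. $F$ has a maximum over all pairs of real angles; it is attained at some $(\gamma,\beta)\in[0,2\pi)\times[0,\pi)$, and it equals $Mn$ with $0.939<M<0.9395$ (that is, it is about $0.939\,n$). -/

import Mathlib

open scoped Matrix

noncomputable section

namespace LocalMaxCutQAOA

/-- The Pauli matrix `X`. -/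
def pauliX : Matrix (Fin 2) (Fin 2) ℂ := !![0, 1; 1, 0]

/-- The Pauli matrix `Z`. -/
def pauliZ : Matrix (Fin 2) (Fin 2) ℂ := !![1, 0; 0, -1]

/-- Operators on the Hilbert space `(ℂ²)^{⊗ V}` of one qubit per vertex, as matrices in the
computational basis, which is indexed by the bit strings `V → Fin 2`. -/
abbrev Operator (V : Type*) := Matrix (V → Fin 2) (V → Fin 2) ℂ

/-- State vectors of the qubits, in the computational basis. -/
abbrev QState (V : Type*) := (V → Fin 2) → ℂ

section Circuit

variable {V : Type*} [Fintype V] [DecidableEq V]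

/-- `M_K`: the tensor product over all qubits of `M` on the qubits in `K` and of the identity on
the other ones. The entry of a tensor product is the product of the entries of its factors. -/
def onQubits (M : Matrix (Fin 2) (Fin 2) ℂ) (K : Finset V) : Operator V :=
  Matrix.of fun x y => ∏ j : V, (if j ∈ K then M else 1) (x j) (y j)

/-- `U(A, θ) = e^{-iθA}`. -/
def gate (A : Operator V) (θ : ℝ) : Operator V :=
  NormedSpace.exp ((-(Complex.I * (θ : ℂ))) • A)

/-- The uniform superposition `|s⟩ = |+⟩^{⊗ n}`, all of whose amplitudes are `1 / 2^{n/2}`. -/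
def uniformState (V : Type*) [Fintype V] : QState V :=
  fun _ => ((1 / Real.sqrt (2 ^ Fintype.card V) : ℝ) : ℂ)

/-- The mixing operator `H_M = ∑ᵥ X_v`. -/
def mixer (V : Type*) [Fintype V] [DecidableEq V] : Operator V :=
  ∑ v : V, onQubits pauliX {v}

/-- The one-round QAOA state `|γ, β⟩ = U(H_M, β) U(H, γ) |s⟩` for the problem Hamiltonian `H`. -/
def qaoaState (H : Operator V) (γ β : ℝ) : QState V :=
  gate (mixer V) β *ᵥ (gate H γ *ᵥ uniformState V)

/-- `⟨ψ| H |ψ⟩`. -/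
def expectation (H : Operator V) (ψ : QState V) : ℂ :=
  star ψ ⬝ᵥ (H *ᵥ ψ)

/-- The local term at a vertex `v` of degree 2, with neighbours `v₁, v₂`:
`3/4 I - 1/4 Z_{v,v₁} - 1/4 Z_{v,v₂} - 1/4 Z_{v₁,v₂}`. -/
def localTerm (G : SimpleGraph V) [DecidableRel G.Adj] (v : V) : Operator V :=
  (3 / 4 : ℂ) • (1 : Operator V)
    - (1 / 4 : ℂ) • ∑ u ∈ G.neighborFinset v, onQubits pauliZ {v, u}
    - (1 / 4 : ℂ) • onQubits pauliZ (G.neighborFinset v)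

/-- The LocalMaxCut Hamiltonian `H₂ = ∑ᵥ H_v` of a 2-regular graph. -/
def hamiltonian (G : SimpleGraph V) [DecidableRel G.Adj] : Operator V :=
  ∑ v : V, localTerm G v

/-- `F(γ, β) = ⟨γ, β| H₂ |γ, β⟩`. -/
def F (G : SimpleGraph V) [DecidableRel G.Adj] (γ β : ℝ) : ℂ :=
  expectation (hamiltonian G) (qaoaState (hamiltonian G) γ β)

end Circuit

end LocalMaxCutQAOA

end

/-!
Since the graph is 2-regular, the LocalMaxCut Hamiltonian is diagonal: it is an Ising energy
`C - ½ ∑ J u w z_u z_w` whose couplings `J` join vertices at distance 1 (weight `1/2`) and 2 (weight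
`1/4`). By linearity, `F` is determined by the correlations `⟨Z_a Z_b⟩` of such pairs.

These correlations are computed for an arbitrary Ising energy in `expectation_pauliZ_pair`. In the
Heisenberg picture the mixer turns `Z_a Z_b` into `(cos 2β + i sin 2β X_a)(cos 2β + i sin 2β X_b)
Z_a Z_b` (`gate_mixer_conj_pauliZ`), because `Z_a Z_b` anticommutes with `X_a` and `X_b` and commutes
with all the other terms of the mixer. As `X_v` flips the bit at `v`, what remains are averages over
all bit strings of `z_a z_b` times a phase, the change of the energy under the flip of `a`, of `b`,
or of both. For fixed `z_a` and `z_b` this change is linear in the other spins, so the average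
separates into a product of cosines, with one factor for each vertex outside of `{a, b}`.

Girth at least 7 makes the neighbourhood of an edge look like a path of seven distinct vertices
(`exists_window`), so all but at most five of these cosines are 1, and the others have explicit
arguments. This gives the same value `energyDensity γ β` for every vertex (`F_eq`).

For fixed `γ` the energy density is `3/4 - B/2 + A sin 4β + (B/2) cos 4β`, whose maximum is below
`0.9395` as soon as `A² < 0.1895² + 0.1895 B`. This is a polynomial inequality in `cos γ`
(`discriminant_lt`). The maximum is attained by periodicity and compactness, and angles with
rational sines and cosines show that it exceeds `0.939`.
-/

namespace LocalMaxCutQAOA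

/-! ### Pauli operators and bit flips -/

/-- The eigenvalue of the Pauli matrix `Z` on the basis state `|s⟩`: `1` for `s = 0`, `-1` for
`s = 1`. -/
noncomputable def spin (s : Fin 2) : ℝ := if s = 0 then 1 else -1

@[simp] lemma spin_zero : spin 0 = 1 := rfl

@[simp] lemma spin_one : spin 1 = -1 := rfl

lemma spin_mul_self (s : Fin 2) : spin s * spin s = 1 := by
  fin_cases s <;> simp

lemma spin_add_one (s : Fin 2) : spin (s + 1) = -spin s := by
  fin_cases s <;> simp

lemma pauliZ_apply (s t : Fin 2) : pauliZ s t = if s = t then (spin s : ℂ) else 0 := by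
  fin_cases s <;> fin_cases t <;> simp [pauliZ]

lemma pauliX_apply (s t : Fin 2) : pauliX s t = if s + 1 = t then 1 else 0 := by
  fin_cases s <;> fin_cases t <;> simp [pauliX]

section BitFlips

variable {V : Type*} [DecidableEq V]

/-- The bit string that is `1` at `v` only. Adding it flips the bit at `v`, since bit strings
`V → Fin 2` are added modulo 2. -/
abbrev bit (v : V) : V → Fin 2 := Pi.single v 1

lemma bit_add_bit (v : V) : bit v + bit v = (0 : V → Fin 2) := by
  ext j
  by_cases h : j = v
  · subst h; simp
  · simp [h]

lemma add_bit_add_bit (x : V → Fin 2) (v : V) : x + bit v + bit v = x := by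
  rw [add_assoc, bit_add_bit, add_zero]

lemma spin_add_bit (x : V → Fin 2) (v u : V) :
    spin ((x + bit v) u) = (if u = v then -1 else 1) * spin (x u) := by
  by_cases h : u = v
  · subst h; simp [spin_add_one]
  · simp [h]

end BitFlips

section Operators

variable {V : Type*} [Fintype V] [DecidableEq V]

lemma onQubits_pauliZ (K : Finset V) :
    onQubits pauliZ K = Matrix.diagonal fun x => ((∏ j ∈ K, spin (x j) : ℝ) : ℂ) := by
  ext x y
  by_cases hxy : x = y
  · subst hxy
    rw [Matrix.diagonal_apply_eq]
    push_cast
    simp only [onQubits, Matrix.of_apply]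
    rw [Finset.prod_congr rfl (g := fun j => if j ∈ K then (spin (x j) : ℂ) else 1)]
    · simp [Finset.prod_ite_mem]
    · intro j _
      split_ifs <;> simp [pauliZ_apply]
  · obtain ⟨j, hj⟩ := Function.ne_iff.mp hxy
    rw [Matrix.diagonal_apply_ne _ hxy]
    refine Finset.prod_eq_zero (Finset.mem_univ j) ?_
    split_ifs <;> simp [pauliZ_apply, hj]

lemma onQubits_pauliX (v : V) :
    onQubits pauliX {v} = Matrix.of fun x y => if x + bit v = y then 1 else 0 := by
  ext x y
  simp only [onQubits, Matrix.of_apply]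
  have key : ∀ j, (if j ∈ ({v} : Finset V) then pauliX else 1) (x j) (y j)
      = if (x + bit v) j = y j then 1 else 0 := by
    intro j
    by_cases h : j = v
    · subst h; simp [pauliX_apply]
    · simp [h, Matrix.one_apply]
  simp_rw [key, Fintype.prod_ite_zero, funext_iff]
  simp

lemma onQubits_pauliX_mulVec (v : V) (ψ : QState V) :
    onQubits pauliX {v} *ᵥ ψ = fun x => ψ (x + bit v) := by
  ext x
  simp [onQubits_pauliX, Matrix.mulVec, dotProduct]

lemma onQubits_pauliX_mul_self (v : V) :
    (onQubits pauliX {v} : Operator V) * onQubits pauliX {v} = 1 := by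
  refine Matrix.ext_of_mulVec_single fun i => ?_
  simp only [← Matrix.mulVec_mulVec, onQubits_pauliX_mulVec, add_bit_add_bit, Matrix.one_mulVec]

lemma onQubits_pauliX_commute (u v : V) :
    Commute (onQubits pauliX {u} : Operator V) (onQubits pauliX {v}) := by
  refine Matrix.ext_of_mulVec_single fun i => ?_
  simp only [← Matrix.mulVec_mulVec, onQubits_pauliX_mulVec, add_right_comm]

lemma onQubits_pauliX_isHermitian (v : V) : (onQubits pauliX {v} : Operator V).IsHermitian := by
  ext x y
  have : y + bit v = x ↔ x + bit v = y :=
    ⟨fun h => by rw [← h, add_bit_add_bit], fun h => by rw [← h, add_bit_add_bit]⟩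
  simp [onQubits_pauliX, Matrix.conjTranspose_apply, this, apply_ite]

lemma mixer_isHermitian : (mixer V).IsHermitian :=
  isSelfAdjoint_sum _ fun v _ => onQubits_pauliX_isHermitian v

/-- Moving `Z_K` past `X_v` changes the sign exactly if `v ∈ K`. -/
lemma onQubits_pauliZ_mul_pauliX (K : Finset V) (v : V) :
    onQubits pauliZ K * onQubits pauliX {v}
      = (if v ∈ K then -1 else 1 : ℂ) • (onQubits pauliX {v} * onQubits pauliZ K) := by
  ext x y
  rw [onQubits_pauliZ, Matrix.diagonal_mul, Matrix.smul_apply, Matrix.mul_diagonal]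
  simp only [onQubits_pauliX, Matrix.of_apply]
  by_cases h : x + bit v = y
  · subst h
    have : ∏ j ∈ K, spin ((x + bit v) j) = (if v ∈ K then -1 else 1) * ∏ j ∈ K, spin (x j) := by
      simp_rw [spin_add_bit, Finset.prod_mul_distrib, Finset.prod_ite_eq']
    rw [this]
    split_ifs <;> simp
  · simp [h]

lemma onQubits_pauliZ_mul_self (K : Finset V) :
    onQubits pauliZ K * onQubits pauliZ K = 1 := by
  rw [onQubits_pauliZ, Matrix.diagonal_mul_diagonal, ← Matrix.diagonal_one]
  congr 1
  ext x
  rw [← Complex.ofReal_mul, ← Finset.prod_mul_distrib]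
  simp [spin_mul_self]

end Operators

/-! ### Exponentials of involutions -/

open Nat in
/-- The exponential series of an idempotent `P` collapses to `1 + (e^t - 1) P`. -/
lemma exp_smul_of_isIdempotentElem {m : Type*} [Fintype m] [DecidableEq m]
    {P : Matrix m m ℂ} (hP : P * P = P) (t : ℂ) :
    NormedSpace.exp (t • P) = 1 + (Complex.exp t - 1) • P := by
  rw [NormedSpace.exp_eq_tsum ℂ]
  have hpow : ∀ n : ℕ, P ^ (n + 1) = P := by
    intro n
    induction n with
    | zero => simp
    | succ n ih => rw [pow_succ, ih, hP]
  have h1 : HasSum (fun n : ℕ => ((n ! : ℂ)⁻¹ * t ^ n) • P) (Complex.exp t • P) := by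
    have := NormedSpace.expSeries_div_hasSum_exp t
    rw [← Complex.exp_eq_exp_ℂ] at this
    refine HasSum.smul_const ?_ P
    simpa [div_eq_inv_mul] using this
  have h2 : HasSum (fun n : ℕ => if n = 0 then 1 - P else 0) (1 - P) := hasSum_ite_eq 0 (1 - P)
  have h3 := h1.add h2
  have : (fun n : ℕ => ((n ! : ℂ)⁻¹) • (t • P) ^ n)
      = fun n : ℕ => ((n ! : ℂ)⁻¹ * t ^ n) • P + if n = 0 then 1 - P else 0 := by
    ext1 n
    cases n with
    | zero => simp
    | succ n => simp [smul_pow, hpow, smul_smul]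
  simp only [this]
  rw [h3.tsum_eq, sub_smul, one_smul]
  abel

/-- Euler's formula for an involution, through the idempotent `(1 + A) / 2`. -/
lemma exp_I_smul_of_involution {m : Type*} [Fintype m] [DecidableEq m]
    {A : Matrix m m ℂ} (hA : A * A = 1) (θ : ℝ) :
    NormedSpace.exp ((Complex.I * θ) • A)
      = (Real.cos θ : ℂ) • 1 + (Complex.I * (Real.sin θ : ℂ)) • A := by
  have hP : ((1 / 2 : ℂ) • (1 + A)) * ((1 / 2 : ℂ) • (1 + A)) = (1 / 2 : ℂ) • (1 + A) := by
    rw [smul_mul_smul_comm, mul_add, add_mul, add_mul, hA, one_mul, mul_one, one_mul]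
    module
  have hQ : (1 : Matrix m m ℂ) * 1 = 1 := one_mul 1
  have hsplit : (Complex.I * θ) • A
      = (2 * (Complex.I * θ)) • ((1 / 2 : ℂ) • (1 + A)) + (-(Complex.I * θ)) • 1 := by
    module
  have hcomm : Commute ((2 * (Complex.I * (θ : ℂ))) • ((1 / 2 : ℂ) • (1 + A)))
      ((-(Complex.I * (θ : ℂ))) • (1 : Matrix m m ℂ)) :=
    (Commute.one_right _).smul_right _
  rw [hsplit, Matrix.exp_add_of_commute _ _ hcomm, exp_smul_of_isIdempotentElem hP,
    exp_smul_of_isIdempotentElem hQ]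
  have e1 : Complex.exp (Complex.I * θ) = Complex.cos θ + Complex.sin θ * Complex.I := by
    rw [mul_comm, Complex.exp_mul_I]
  have e2 : Complex.exp (-(Complex.I * θ)) = Complex.cos θ - Complex.sin θ * Complex.I := by
    rw [mul_comm, ← neg_mul, Complex.exp_mul_I, Complex.cos_neg, Complex.sin_neg]
    ring
  have e3 : Complex.exp (2 * (Complex.I * θ)) * Complex.exp (-(Complex.I * θ))
      = Complex.exp (Complex.I * θ) := by
    rw [← Complex.exp_add]; congr 1; ring
  have hm : (1 + (Complex.exp (2 * (Complex.I * θ)) - 1) • ((1 / 2 : ℂ) • (1 + A)))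
        * (1 + (Complex.exp (-(Complex.I * θ)) - 1) • (1 : Matrix m m ℂ))
      = ((1 / 2 : ℂ) * (Complex.exp (-(Complex.I * θ))
          + Complex.exp (2 * (Complex.I * θ)) * Complex.exp (-(Complex.I * θ)))) • 1
        + ((1 / 2 : ℂ) * (Complex.exp (2 * (Complex.I * θ)) * Complex.exp (-(Complex.I * θ))
          - Complex.exp (-(Complex.I * θ)))) • A := by
    rw [show (1 + (Complex.exp (-(Complex.I * θ)) - 1) • (1 : Matrix m m ℂ))
      = Complex.exp (-(Complex.I * θ)) • (1 : Matrix m m ℂ) by module, mul_smul_comm, mul_one]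
    module
  rw [hm, e3, e1, e2]
  push_cast
  module

/-! ### The mixer in the Heisenberg picture -/

section Heisenberg

variable {V : Type*} [Fintype V] [DecidableEq V]

lemma gate_conjTranspose {A : Operator V} (hA : A.IsHermitian) (θ : ℝ) :
    (gate A θ)ᴴ = gate A (-θ) := by
  rw [gate, gate, ← Matrix.exp_conjTranspose, Matrix.conjTranspose_smul, hA.eq]
  congr 2
  simp

lemma gate_diagonal (h : (V → Fin 2) → ℝ) (γ : ℝ) :
    gate (Matrix.diagonal fun x => (h x : ℂ)) γ
      = Matrix.diagonal fun x => Complex.exp (-(Complex.I * γ) * h x) := by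
  rw [gate, ← Matrix.diagonal_smul, Matrix.exp_diagonal]
  congr 1
  ext x
  rw [Pi.coe_exp, ← Complex.exp_eq_exp_ℂ]
  rfl

/-- The evolution of `Z_a Z_b` under the mixer in the Heisenberg picture. Since `Z_a Z_b`
anticommutes with `X_a` and `X_b` and commutes with the other `X_v`, conjugating the mixer by it
only changes the signs of these two terms, and all the other ones cancel. -/
lemma gate_mixer_conj_pauliZ {a b : V} (hab : a ≠ b) (β : ℝ) :
    gate (mixer V) (-β) * onQubits pauliZ {a, b} * gate (mixer V) β
      = ((Real.cos (2 * β) : ℂ) • 1 + (Complex.I * (Real.sin (2 * β) : ℂ)) • onQubits pauliX {a})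
        * ((Real.cos (2 * β) : ℂ) • 1
          + (Complex.I * (Real.sin (2 * β) : ℂ)) • onQubits pauliX {b})
        * onQubits pauliZ {a, b} := by
  set Z : Operator V := onQubits pauliZ {a, b} with hZ
  set Xa : Operator V := onQubits pauliX {a} with hXa
  set Xb : Operator V := onQubits pauliX {b} with hXb
  have hZZ : Z * Z = 1 := onQubits_pauliZ_mul_self _
  have hinv : Z⁻¹ = Z := Matrix.inv_eq_right_inv hZZ
  have hU : IsUnit Z := IsUnit.of_mul_eq_one Z hZZ
  have hconj : Z * mixer V * Z = mixer V - (2 : ℂ) • (Xa + Xb) := by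
    have h1 : ∀ v, Z * onQubits pauliX {v} * Z
        = onQubits pauliX {v} - ((if v = a then (2 : ℂ) • Xa else 0)
          + if v = b then (2 : ℂ) • Xb else 0) := by
      intro v
      rw [hZ, onQubits_pauliZ_mul_pauliX, smul_mul_assoc, mul_assoc, ← hZ, hZZ, mul_one]
      by_cases hva : v = a
      · subst hva
        simp only [Finset.mem_insert, true_or, if_true, hab, if_false]
        module
      · by_cases hvb : v = b
        · subst hvb
          simp only [Finset.mem_insert, Finset.mem_singleton, or_true, if_true, hva, if_false]
          module
        · simp [hva, hvb]
    rw [mixer, Finset.mul_sum, Finset.sum_mul, Finset.sum_congr rfl fun v _ => h1 v,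
      Finset.sum_sub_distrib, Finset.sum_add_distrib]
    simp [smul_add]
  have hmix : ∀ v, Commute (mixer V) (onQubits pauliX {v}) := fun v =>
    Commute.sum_left _ _ _ fun u _ => onQubits_pauliX_commute u v
  have hmove : Z * gate (mixer V) β
      = NormedSpace.exp ((-(Complex.I * (β : ℂ))) • (mixer V - (2 : ℂ) • (Xa + Xb))) * Z := by
    have := Matrix.exp_conj Z ((-(Complex.I * (β : ℂ))) • mixer V) hU
    rw [hinv, mul_smul_comm, smul_mul_assoc, hconj] at this
    rw [this, mul_assoc, hZZ, mul_one]
    rfl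
  have hc : Commute (mixer V) (mixer V - (2 : ℂ) • (Xa + Xb)) :=
    (Commute.refl _).sub_right (((hmix a).add_right (hmix b)).smul_right _)
  rw [mul_assoc, hmove, ← mul_assoc, gate,
    ← Matrix.exp_add_of_commute _ _ ((hc.smul_left _).smul_right _)]
  have hsum : (-(Complex.I * ((-β : ℝ) : ℂ))) • mixer V
        + (-(Complex.I * (β : ℂ))) • (mixer V - (2 : ℂ) • (Xa + Xb))
      = (Complex.I * ((2 * β : ℝ) : ℂ)) • Xa + (Complex.I * ((2 * β : ℝ) : ℂ)) • Xb := by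
    push_cast
    module
  rw [hsum, Matrix.exp_add_of_commute _ _
      (((onQubits_pauliX_commute a b).smul_left _).smul_right _),
    exp_I_smul_of_involution (onQubits_pauliX_mul_self a),
    exp_I_smul_of_involution (onQubits_pauliX_mul_self b)]

end Heisenberg

/-! ### Sums over bit strings -/

lemma star_uniformState_mul_self {V : Type*} [Fintype V] (x : V → Fin 2) :
    star (uniformState V x) * uniformState V x = ((1 / 2 ^ Fintype.card V : ℝ) : ℂ) := by
  rw [uniformState, Complex.star_def, Complex.conj_ofReal, ← Complex.ofReal_mul,
    div_mul_div_comm, one_mul, Real.mul_self_sqrt (by positivity)]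

section SpinSums

variable {V : Type*} [Fintype V] [DecidableEq V]

/-- A sum over all bit strings of a product in which the bits at `a` and `b` may enter every
factor, and each other bit enters one factor only: the sums over the other bits separate. -/
lemma sum_bitStrings_mul_prod {a b : V} (hab : a ≠ b) (Φ : Fin 2 → Fin 2 → ℂ)
    (g : Fin 2 → Fin 2 → V → Fin 2 → ℂ) :
    ∑ x : V → Fin 2, Φ (x a) (x b) * ∏ u ∈ ({a, b} : Finset V)ᶜ, g (x a) (x b) u (x u)
      = ∑ σ, ∑ τ, Φ σ τ * ∏ u ∈ ({a, b} : Finset V)ᶜ, ∑ s, g σ τ u s := by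
  -- Factors at `a` and `b` that restrict the sum to `x a = σ` and `x b = τ`.
  let f : Fin 2 → Fin 2 → V → Fin 2 → ℂ := fun σ τ u s =>
    if u = a then if s = σ then 1 else 0 else if u = b then if s = τ then 1 else 0 else g σ τ u s
  have hsplit : ∀ F : V → ℂ, ∏ u, F u = F a * F b * ∏ u ∈ ({a, b} : Finset V)ᶜ, F u := by
    intro F
    rw [← Finset.prod_mul_prod_compl {a, b} F, Finset.prod_pair hab]
  have hf : ∀ σ τ, ∀ u ∈ ({a, b} : Finset V)ᶜ, f σ τ u = g σ τ u := by
    intro σ τ u hu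
    simp only [Finset.mem_compl, Finset.mem_insert, Finset.mem_singleton, not_or] at hu
    ext s
    simp [f, hu.1, hu.2]
  have h1 : ∀ σ τ, ∏ u ∈ ({a, b} : Finset V)ᶜ, ∑ s, g σ τ u s
      = ∑ x : V → Fin 2, (if x a = σ then 1 else 0) * (if x b = τ then 1 else 0)
        * ∏ u ∈ ({a, b} : Finset V)ᶜ, g σ τ u (x u) := by
    intro σ τ
    have h2 := Fintype.prod_sum (f σ τ)
    rw [hsplit] at h2
    have ha : ∑ s, f σ τ a s = 1 := by simp [f]
    have hb : ∑ s, f σ τ b s = 1 := by simp [f, hab.symm]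
    rw [ha, hb, one_mul, one_mul, Finset.prod_congr rfl fun u hu => by rw [hf σ τ u hu]] at h2
    rw [h2]
    refine Finset.sum_congr rfl fun x _ => ?_
    rw [hsplit, Finset.prod_congr rfl fun u hu => by rw [hf σ τ u hu]]
    simp [f, hab.symm]
  simp_rw [h1, Finset.mul_sum]
  conv_rhs =>
    enter [2, σ]
    rw [Finset.sum_comm]
  rw [Finset.sum_comm]
  refine Finset.sum_congr rfl fun x _ => ?_
  rw [Finset.sum_eq_single (x a), Finset.sum_eq_single (x b)]
  · simp
  · intro τ _ hτ; simp [hτ.symm]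
  · simp
  · intro σ _ hσ; simp [hσ.symm]
  · simp

end SpinSums

/-! ### Correlations in the QAOA state of an Ising Hamiltonian -/

section Ising

variable {V : Type*} [Fintype V] [DecidableEq V]

/-- The energy `C - ½ ∑_{u,w} J u w z_u z_w` of a bit string with spins `z`. Every unordered pair
is counted twice in the double sum. -/
noncomputable def isingEnergy (C : ℝ) (J : V → V → ℝ) (x : V → Fin 2) : ℝ :=
  C - 1 / 2 * ∑ u, ∑ w, J u w * (spin (x u) * spin (x w))

variable {C : ℝ} {J : V → V → ℝ}

lemma isingEnergy_sub_add_bit (hsymm : ∀ u w, J u w = J w u) (hdiag : ∀ u, J u u = 0)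
    (x : V → Fin 2) (a : V) :
    isingEnergy C J x - isingEnergy C J (x + bit a)
      = -2 * spin (x a) * ∑ u, J a u * spin (x u) := by
  have h : ∀ u w, J u w * (spin ((x + bit a) u) * spin ((x + bit a) w))
      = J u w * (spin (x u) * spin (x w))
        - (if u = a then 2 * (spin (x a) * (J a w * spin (x w))) else 0)
        - (if w = a then 2 * (spin (x a) * (J a u * spin (x u))) else 0) := by
    intro u w
    rw [spin_add_bit, spin_add_bit]
    by_cases hu : u = a <;> by_cases hw : w = a
    · subst hu; subst hw; simp [hdiag]
    · subst hu; simp [hw]; ring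
    · subst hw; simp [hu, hsymm u w]; ring
    · simp [hu, hw]
  simp only [isingEnergy, h, Finset.sum_sub_distrib, Finset.sum_ite_eq', Finset.mem_univ, if_true]
  rw [Finset.sum_comm
    (f := fun u w => if u = a then 2 * (spin (x a) * (J a w * spin (x w))) else 0)]
  simp only [Finset.sum_ite_eq', Finset.mem_univ, if_true, ← Finset.mul_sum]
  ring

lemma isingEnergy_sub_add_bit_pair (hsymm : ∀ u w, J u w = J w u) (hdiag : ∀ u, J u u = 0)
    (x : V → Fin 2) {a b : V} (hab : a ≠ b) :
    isingEnergy C J x - isingEnergy C J (x + bit a)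
      = -2 * J a b * (spin (x a) * spin (x b))
        + ∑ u ∈ ({a, b} : Finset V)ᶜ, -2 * (J a u * spin (x a)) * spin (x u) := by
  rw [isingEnergy_sub_add_bit hsymm hdiag, ← Finset.sum_add_sum_compl {a, b},
    Finset.sum_pair hab, hdiag, mul_add, Finset.mul_sum]
  congr 1
  · ring
  · exact Finset.sum_congr rfl fun u _ => by ring

lemma isingEnergy_sub_add_two_bits (hsymm : ∀ u w, J u w = J w u) (hdiag : ∀ u, J u u = 0)
    (x : V → Fin 2) {a b : V} (hab : a ≠ b) :
    isingEnergy C J x - isingEnergy C J (x + bit a + bit b)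
      = ∑ u ∈ ({a, b} : Finset V)ᶜ,
          -2 * (J a u * spin (x a) + J b u * spin (x b)) * spin (x u) := by
  have h1 := isingEnergy_sub_add_bit_pair (C := C) hsymm hdiag x hab
  have h2 := isingEnergy_sub_add_bit_pair (C := C) hsymm hdiag (x + bit a) hab.symm
  rw [Finset.pair_comm b a] at h2
  have h3 : ∑ u ∈ ({a, b} : Finset V)ᶜ, -2 * (J b u * spin ((x + bit a) b)) * spin ((x + bit a) u)
      = ∑ u ∈ ({a, b} : Finset V)ᶜ, -2 * (J b u * spin (x b)) * spin (x u) := by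
    refine Finset.sum_congr rfl fun u hu => ?_
    simp only [Finset.mem_compl, Finset.mem_insert, Finset.mem_singleton, not_or] at hu
    simp [hab.symm, hu.1]
  rw [h3, spin_add_bit, spin_add_bit, if_neg hab.symm, if_pos rfl, hsymm b a] at h2
  calc _ = (isingEnergy C J x - isingEnergy C J (x + bit a))
        + (isingEnergy C J (x + bit a) - isingEnergy C J (x + bit a + bit b)) := by ring
    _ = ∑ u ∈ ({a, b} : Finset V)ᶜ, -2 * (J a u * spin (x a)) * spin (x u)
        + ∑ u ∈ ({a, b} : Finset V)ᶜ, -2 * (J b u * spin (x b)) * spin (x u) := by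
      rw [h1, h2]; ring
    _ = _ := by
      rw [← Finset.sum_add_distrib]
      exact Finset.sum_congr rfl fun u _ => by ring

/-- The spin at one vertex averages a phase to a cosine. -/
lemma sum_exp_spin (t : ℝ) :
    ∑ s : Fin 2, Complex.exp (Complex.I * ((t * spin s : ℝ) : ℂ)) = 2 * (Real.cos t : ℂ) := by
  rw [Fin.sum_univ_two, spin_zero, spin_one, Complex.ofReal_cos, Complex.two_cos]
  push_cast
  congr 2 <;> ring

/-- The normalized sum over all bit strings of `z_a z_b` times a phase which is linear in the
spins outside of `{a, b}`. -/
lemma sum_spin_mul_spin_mul_exp {a b : V} (hab : a ≠ b) (c : Fin 2 → Fin 2 → ℝ)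
    (t : Fin 2 → Fin 2 → V → ℝ) :
    ((1 / 2 ^ Fintype.card V : ℝ) : ℂ) * ∑ x : V → Fin 2, ((spin (x a) * spin (x b) : ℝ) : ℂ)
        * Complex.exp (Complex.I * ((c (x a) (x b)
          + ∑ u ∈ ({a, b} : Finset V)ᶜ, t (x a) (x b) u * spin (x u) : ℝ) : ℂ))
      = 1 / 4 * ∑ σ, ∑ τ, ((spin σ * spin τ : ℝ) : ℂ) * Complex.exp (Complex.I * (c σ τ : ℂ))
        * ((∏ u ∈ ({a, b} : Finset V)ᶜ, Real.cos (t σ τ u) : ℝ) : ℂ) := by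
  have h := sum_bitStrings_mul_prod hab
    (fun σ τ => ((spin σ * spin τ : ℝ) : ℂ) * Complex.exp (Complex.I * (c σ τ : ℂ)))
    (fun σ τ u s => Complex.exp (Complex.I * ((t σ τ u * spin s : ℝ) : ℂ)))
  have hcard : Fintype.card V = 2 + (({a, b} : Finset V)ᶜ).card := by
    rw [← Finset.card_pair hab, Finset.card_add_card_compl]
  have hx : ∀ x : V → Fin 2, ((spin (x a) * spin (x b) : ℝ) : ℂ)
        * Complex.exp (Complex.I * ((c (x a) (x b)
          + ∑ u ∈ ({a, b} : Finset V)ᶜ, t (x a) (x b) u * spin (x u) : ℝ) : ℂ))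
      = ((spin (x a) * spin (x b) : ℝ) : ℂ) * Complex.exp (Complex.I * (c (x a) (x b) : ℂ))
        * ∏ u ∈ ({a, b} : Finset V)ᶜ,
          Complex.exp (Complex.I * ((t (x a) (x b) u * spin (x u) : ℝ) : ℂ)) := by
    intro x
    rw [← Complex.exp_sum, ← Finset.mul_sum, mul_assoc, ← Complex.exp_add, ← mul_add]
    push_cast
    rfl
  simp_rw [hx]
  rw [h]
  simp_rw [sum_exp_spin, Finset.prod_mul_distrib, Finset.prod_const]
  rw [hcard, Finset.mul_sum, Finset.mul_sum]
  refine Finset.sum_congr rfl fun σ _ => ?_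
  rw [Finset.mul_sum, Finset.mul_sum]
  refine Finset.sum_congr rfl fun τ _ => ?_
  have h2 : (2 : ℂ) ^ (({a, b} : Finset V)ᶜ).card ≠ 0 := pow_ne_zero _ two_ne_zero
  push_cast
  rw [pow_add]
  field_simp
  ring

/-- The overlap of the phase-separated uniform state with its image under `X_a`, weighted by
`z_a z_b`. -/
lemma sum_exp_sub_add_bit (hsymm : ∀ u w, J u w = J w u) (hdiag : ∀ u, J u u = 0)
    {a b : V} (hab : a ≠ b) (γ : ℝ) :
    ((1 / 2 ^ Fintype.card V : ℝ) : ℂ) * ∑ x : V → Fin 2, ((spin (x a) * spin (x b) : ℝ) : ℂ)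
        * Complex.exp (Complex.I
          * ((γ * (isingEnergy C J x - isingEnergy C J (x + bit a)) : ℝ) : ℂ))
      = -(Complex.I * (Real.sin (2 * γ * J a b) : ℂ)
        * ((∏ u ∈ ({a, b} : Finset V)ᶜ, Real.cos (2 * γ * J a u) : ℝ) : ℂ)) := by
  have hx : ∀ x : V → Fin 2, γ * (isingEnergy C J x - isingEnergy C J (x + bit a))
      = -(2 * γ * J a b * (spin (x a) * spin (x b)))
        + ∑ u ∈ ({a, b} : Finset V)ᶜ, -(2 * γ * J a u) * spin (x a) * spin (x u) := by
    intro x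
    rw [isingEnergy_sub_add_bit_pair hsymm hdiag x hab, mul_add, Finset.mul_sum]
    congr 1
    · ring
    · exact Finset.sum_congr rfl fun u _ => by ring
  simp_rw [hx]
  rw [sum_spin_mul_spin_mul_exp hab (fun σ τ => -(2 * γ * J a b * (spin σ * spin τ)))
    (fun σ _ u => -(2 * γ * J a u) * spin σ)]
  have e1 : Complex.exp (Complex.I * ((2 * γ * J a b : ℝ) : ℂ))
      = (Real.cos (2 * γ * J a b) : ℂ) + (Real.sin (2 * γ * J a b) : ℂ) * Complex.I := by
    rw [mul_comm, Complex.exp_mul_I, Complex.ofReal_cos, Complex.ofReal_sin]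
  have e2 : Complex.exp (Complex.I * ((-(2 * γ * J a b) : ℝ) : ℂ))
      = (Real.cos (2 * γ * J a b) : ℂ) - (Real.sin (2 * γ * J a b) : ℂ) * Complex.I := by
    rw [mul_comm, Complex.exp_mul_I, ← Complex.ofReal_cos, ← Complex.ofReal_sin, Real.cos_neg,
      Real.sin_neg]
    push_cast
    ring
  simp only [Fin.sum_univ_two, spin_zero, spin_one, mul_one, mul_neg, neg_neg, e1, e2,
    Real.cos_neg]
  push_cast
  ring

/-- The overlap of the phase-separated uniform state with its image under `X_a X_b`, weighted by
`z_a z_b`. The coupling of `a` and `b` drops out, since flipping both bits preserves `z_a z_b`. -/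
lemma sum_exp_sub_add_two_bits (hsymm : ∀ u w, J u w = J w u) (hdiag : ∀ u, J u u = 0)
    {a b : V} (hab : a ≠ b) (γ : ℝ) :
    ((1 / 2 ^ Fintype.card V : ℝ) : ℂ) * ∑ x : V → Fin 2, ((spin (x a) * spin (x b) : ℝ) : ℂ)
        * Complex.exp (Complex.I
          * ((γ * (isingEnergy C J x - isingEnergy C J (x + bit a + bit b)) : ℝ) : ℂ))
      = ((1 / 2 * (∏ u ∈ ({a, b} : Finset V)ᶜ, Real.cos (2 * γ * (J a u + J b u))
        - ∏ u ∈ ({a, b} : Finset V)ᶜ, Real.cos (2 * γ * (J a u - J b u))) : ℝ) : ℂ) := by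
  have hx : ∀ x : V → Fin 2, γ * (isingEnergy C J x - isingEnergy C J (x + bit a + bit b))
      = 0 + ∑ u ∈ ({a, b} : Finset V)ᶜ,
        -(2 * γ * (J a u * spin (x a) + J b u * spin (x b))) * spin (x u) := by
    intro x
    rw [isingEnergy_sub_add_two_bits hsymm hdiag x hab, Finset.mul_sum, zero_add]
    exact Finset.sum_congr rfl fun u _ => by ring
  simp_rw [hx]
  rw [sum_spin_mul_spin_mul_exp hab (fun _ _ => 0)
    (fun σ τ u => -(2 * γ * (J a u * spin σ + J b u * spin τ)))]
  have e : ∀ u, Real.cos (2 * γ * (-J a u + J b u)) = Real.cos (2 * γ * (J a u + -J b u)) := by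
    intro u
    rw [← Real.cos_neg]
    congr 1
    ring
  have e' : ∀ u, Real.cos (2 * γ * (-J a u + -J b u)) = Real.cos (2 * γ * (J a u + J b u)) := by
    intro u
    rw [← Real.cos_neg]
    congr 1
    ring
  simp only [Fin.sum_univ_two, spin_zero, spin_one, mul_one, mul_neg, neg_neg, e, e',
    Real.cos_neg, sub_eq_add_neg, Complex.ofReal_zero, mul_zero, Complex.exp_zero]
  push_cast
  ring

lemma sum_spin_mul_spin {a b : V} (hab : a ≠ b) :
    ∑ x : V → Fin 2, ((spin (x a) * spin (x b) : ℝ) : ℂ) = 0 := by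
  have h := sum_bitStrings_mul_prod hab (fun σ τ => ((spin σ * spin τ : ℝ) : ℂ))
    (fun _ _ _ _ => 1)
  simpa [Fin.sum_univ_two] using h

lemma expectation_gate_mulVec (A B : Operator V) (hB : B.IsHermitian) (β : ℝ) (φ : QState V) :
    expectation A (gate B β *ᵥ φ) = star φ ⬝ᵥ ((gate B (-β) * A * gate B β) *ᵥ φ) := by
  rw [expectation, Matrix.star_mulVec, gate_conjTranspose hB, ← Matrix.dotProduct_mulVec,
    Matrix.mulVec_mulVec, Matrix.mulVec_mulVec]

/-- The correlation `⟨Z_a Z_b⟩` in the one-round QAOA state of an arbitrary Ising Hamiltonian. The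
first summand comes from flipping one of the bits at `a` and `b`, the second one from flipping
both. -/
theorem expectation_pauliZ_pair (hsymm : ∀ u w, J u w = J w u) (hdiag : ∀ u, J u u = 0)
    {a b : V} (hab : a ≠ b) (γ β : ℝ) :
    expectation (onQubits pauliZ {a, b})
        (qaoaState (Matrix.diagonal fun x => (isingEnergy C J x : ℂ)) γ β)
      = ((-(Real.sin (2 * β) * Real.cos (2 * β) * Real.sin (2 * γ * J a b)
          * (∏ u ∈ ({a, b} : Finset V)ᶜ, Real.cos (2 * γ * J a u)
            + ∏ u ∈ ({a, b} : Finset V)ᶜ, Real.cos (2 * γ * J b u)))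
        - Real.sin (2 * β) ^ 2 / 2
          * (∏ u ∈ ({a, b} : Finset V)ᶜ, Real.cos (2 * γ * (J a u + J b u))
            - ∏ u ∈ ({a, b} : Finset V)ᶜ, Real.cos (2 * γ * (J a u - J b u))) : ℝ) : ℂ) := by
  set h := isingEnergy C J with hh
  set φ : QState V := gate (Matrix.diagonal fun x => (h x : ℂ)) γ *ᵥ uniformState V with hφ
  set N : ℂ := ((1 / 2 ^ Fintype.card V : ℝ) : ℂ) with hN
  have hφx : ∀ x, φ x = Complex.exp (-(Complex.I * γ) * h x) * uniformState V x := by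
    intro x
    rw [hφ, gate_diagonal, Matrix.mulVec_diagonal]
  have hover : ∀ x y, star (φ x) * φ y
      = N * Complex.exp (Complex.I * ((γ * (h x - h y) : ℝ) : ℂ)) := by
    intro x y
    have h1 : uniformState V y = uniformState V x := rfl
    have h2 : star (Complex.exp (-(Complex.I * γ) * h x)) = Complex.exp (Complex.I * γ * h x) := by
      rw [Complex.star_def, ← Complex.exp_conj]
      simp
    rw [hφx, hφx, h1, star_mul', h2, hN, ← star_uniformState_mul_self x]
    rw [show Complex.exp (Complex.I * ((γ * (h x - h y) : ℝ) : ℂ))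
        = Complex.exp (Complex.I * γ * h x) * Complex.exp (-(Complex.I * γ) * h y) by
      rw [← Complex.exp_add]; congr 1; push_cast; ring]
    ring
  set S : ℂ := (Real.sin (2 * β) : ℂ)
  set K : ℂ := (Real.cos (2 * β) : ℂ)
  set ψ : QState V := onQubits pauliZ {a, b} *ᵥ φ with hψ
  have hψx : ∀ x, ψ x = ((spin (x a) * spin (x b) : ℝ) : ℂ) * φ x := by
    intro x
    rw [hψ, onQubits_pauliZ, Matrix.mulVec_diagonal, Finset.prod_pair hab]
  have hterm : ∀ x, star (φ x) * ψ x = N * ((spin (x a) * spin (x b) : ℝ) : ℂ) := by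
    intro x
    have := hover x x
    rw [sub_self, mul_zero, Complex.ofReal_zero, mul_zero, Complex.exp_zero, mul_one] at this
    rw [hψx, mul_left_comm, this, mul_comm]
  have hterm_a : ∀ x, star (φ x) * ψ (x + bit a) = -(N * (((spin (x a) * spin (x b) : ℝ) : ℂ)
      * Complex.exp (Complex.I * ((γ * (h x - h (x + bit a)) : ℝ) : ℂ)))) := by
    intro x
    rw [hψx, mul_left_comm, hover, spin_add_bit, spin_add_bit, if_pos rfl, if_neg hab.symm]
    push_cast
    ring
  have hterm_b : ∀ x, star (φ x) * ψ (x + bit b) = -(N * (((spin (x b) * spin (x a) : ℝ) : ℂ)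
      * Complex.exp (Complex.I * ((γ * (h x - h (x + bit b)) : ℝ) : ℂ)))) := by
    intro x
    rw [hψx, mul_left_comm, hover, spin_add_bit, spin_add_bit, if_pos rfl, if_neg hab]
    push_cast
    ring
  have hterm_ab : ∀ x, star (φ x) * ψ (x + bit a + bit b)
      = N * (((spin (x a) * spin (x b) : ℝ) : ℂ)
        * Complex.exp (Complex.I * ((γ * (h x - h (x + bit a + bit b)) : ℝ) : ℂ))) := by
    intro x
    rw [hψx, mul_left_comm, hover, spin_add_bit, spin_add_bit, spin_add_bit, spin_add_bit,
      if_pos rfl, if_neg hab, if_neg hab.symm, if_pos rfl]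
    push_cast
    ring
  rw [qaoaState, expectation_gate_mulVec _ _ mixer_isHermitian, gate_mixer_conj_pauliZ hab,
    ← Matrix.mulVec_mulVec, ← Matrix.mulVec_mulVec, ← hφ, ← hψ]
  have hexpand : star φ ⬝ᵥ ((K • 1 + (Complex.I * S) • onQubits pauliX {a}) *ᵥ
        ((K • 1 + (Complex.I * S) • onQubits pauliX {b}) *ᵥ ψ))
      = K ^ 2 * ∑ x, star (φ x) * ψ x
        + Complex.I * S * K * (∑ x, star (φ x) * ψ (x + bit a))
        + Complex.I * S * K * (∑ x, star (φ x) * ψ (x + bit b))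
        - S ^ 2 * ∑ x, star (φ x) * ψ (x + bit a + bit b) := by
    simp only [Finset.mul_sum]
    rw [← Finset.sum_add_distrib, ← Finset.sum_add_distrib, ← Finset.sum_sub_distrib]
    refine Finset.sum_congr rfl fun x _ => ?_
    simp only [Matrix.add_mulVec, Matrix.smul_mulVec, Matrix.one_mulVec,
      onQubits_pauliX_mulVec, Pi.add_apply, Pi.smul_apply, Pi.star_apply, smul_eq_mul]
    linear_combination (star (φ x) * S ^ 2 * ψ (x + bit a + bit b)) * Complex.I_sq
  rw [hexpand]
  simp_rw [hterm, hterm_a, hterm_b, hterm_ab, Finset.sum_neg_distrib, ← Finset.mul_sum]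
  rw [sum_spin_mul_spin hab, hN, hh, sum_exp_sub_add_bit hsymm hdiag hab,
    sum_exp_sub_add_bit hsymm hdiag hab.symm, sum_exp_sub_add_two_bits hsymm hdiag hab,
    Finset.pair_comm b a, hsymm b a]
  simp only [S, K]
  push_cast
  linear_combination (Complex.sin (2 * β) * Complex.cos (2 * β) * Complex.sin (2 * γ * J a b)
    * (∏ u ∈ ({a, b} : Finset V)ᶜ, Complex.cos (2 * γ * J a u)
      + ∏ u ∈ ({a, b} : Finset V)ᶜ, Complex.cos (2 * γ * J b u))) * Complex.I_sq

end Ising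

/-! ### The energy density -/

/-- The value of `F` per vertex, as a function of the two angles. -/
noncomputable def energyDensity (γ β : ℝ) : ℝ :=
  3 / 4 + 1 / 32 * Real.sin (4 * β)
      * (3 * Real.sin γ + 4 * Real.sin (2 * γ) + 3 * Real.sin (3 * γ))
    - 1 / 16 * Real.sin (2 * β) ^ 2 * Real.sin γ * Real.cos (γ / 2) ^ 2
      * (Real.sin γ + 4 * Real.sin (2 * γ) + Real.sin (3 * γ))

lemma energyDensity_eq (γ β : ℝ) :
    energyDensity γ β = 3 / 4
      + Real.sin γ * Real.cos γ * (2 + 3 * Real.cos γ) / 8 * Real.sin (4 * β)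
      - (1 + Real.cos γ) * (1 - Real.cos γ ^ 2) * Real.cos γ * (2 + Real.cos γ) / 16
        * (1 - Real.cos (4 * β)) := by
  have h1 : Real.cos (γ / 2) ^ 2 = 1 / 2 + Real.cos γ / 2 := by
    rw [Real.cos_sq, show 2 * (γ / 2) = γ by ring]
  have h2 : Real.sin (2 * β) ^ 2 = 1 / 2 - Real.cos (4 * β) / 2 := by
    rw [Real.sin_sq_eq_half_sub, show 2 * (2 * β) = 4 * β by ring]
  rw [energyDensity, h1, h2, Real.sin_two_mul, Real.sin_three_mul]
  have h3 := Real.sin_sq_add_cos_sq γ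
  set s := Real.sin γ
  set c := Real.cos γ
  have h4 : s ^ 2 = 1 - c ^ 2 := by linarith
  linear_combination (-12 / 32 * Real.sin (4 * β) * s
    - 1 / 64 * (1 - Real.cos (4 * β)) * (1 + c) * (4 + 8 * c - 4 * (s ^ 2 + 1 - c ^ 2))) * h4

/-- The energy density in terms of the correlations along an edge and at distance 2. -/
lemma energyDensity_eq_sub_correlations (γ β : ℝ) :
    energyDensity γ β = 3 / 4
      - 1 / 4 * (2 * (-(2 * Real.sin (2 * β) * Real.cos (2 * β) * Real.sin γ
          * (Real.cos γ * Real.cos (γ / 2) ^ 2))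
        - Real.sin (2 * β) ^ 2 / 2
          * (Real.cos (γ / 2) ^ 2 * Real.cos (3 * γ / 2) ^ 2 - Real.cos (γ / 2) ^ 4)))
      - 1 / 4 * (-(2 * Real.sin (2 * β) * Real.cos (2 * β) * Real.sin (γ / 2)
          * (Real.cos (γ / 2) * Real.cos γ ^ 2))
        - Real.sin (2 * β) ^ 2 / 2
          * (Real.cos (γ / 2) ^ 2 * Real.cos γ ^ 2 * (Real.cos (2 * γ) - 1))) := by
  have hβ : Real.sin (4 * β) = 2 * Real.sin (2 * β) * Real.cos (2 * β) := by
    rw [← Real.sin_two_mul, show 2 * (2 * β) = 4 * β by ring]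
  have hs : Real.sin γ = 2 * Real.sin (γ / 2) * Real.cos (γ / 2) := by
    rw [← Real.sin_two_mul, show 2 * (γ / 2) = γ by ring]
  have hc : Real.cos γ = 2 * Real.cos (γ / 2) ^ 2 - 1 := by
    rw [← Real.cos_two_mul, show 2 * (γ / 2) = γ by ring]
  have hc3 : Real.cos (3 * γ / 2) = 4 * Real.cos (γ / 2) ^ 3 - 3 * Real.cos (γ / 2) := by
    rw [← Real.cos_three_mul, show 3 * (γ / 2) = 3 * γ / 2 by ring]
  have hs3 : Real.sin (3 * γ) = Real.sin γ * (4 * Real.cos γ ^ 2 - 1) := by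
    rw [Real.sin_three_mul]
    linear_combination (-4 * Real.sin γ) * Real.sin_sq_add_cos_sq γ
  rw [energyDensity, hβ, hs3, hc3, Real.sin_two_mul γ, Real.cos_two_mul γ, hs, hc]
  set k := Real.sin (γ / 2) with hk
  set h := Real.cos (γ / 2) with hh
  have h1 : k ^ 2 + h ^ 2 = 1 := Real.sin_sq_add_cos_sq _
  linear_combination (-1 / 4 * Real.sin (2 * β) ^ 2 * h ^ 4
    * (8 * (2 * h ^ 2 - 1) + 4 * (2 * h ^ 2 - 1) ^ 2)) * h1

/-- For fixed `γ`, with `c = cos γ`, this inequality keeps the maximum over `β` of the energy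
density below `0.9395`. It is nearly tight at `c ≈ 0.827`. -/
lemma discriminant_lt (c : ℝ) :
    (1 - c ^ 2) * (c * (2 + 3 * c) / 8) ^ 2
      < 0.1895 ^ 2 + 0.1895 * ((1 + c) * (1 - c ^ 2) * c * (2 + c) / 8) := by
  -- The quartic is the quotient of the difference of the two sides by `(c - 0.8269) ^ 2`; the
  -- remainder is a small linear polynomial.
  have hq : 0.005 ≤ 0.052488629057585445 + 0.1961531142131875 * c + 0.41018838546875 * c ^ 2
      + 0.396378125 * c ^ 3 + 0.140625 * c ^ 4 := by
    nlinarith [sq_nonneg (c ^ 2 + 1.40936 * c + 0.4), sq_nonneg (c + 1.0234)]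
  nlinarith [mul_le_mul_of_nonneg_right hq (sq_nonneg (c - 0.8269)), sq_nonneg (c - 0.8269)]

lemma neg_lt_curvature {c : ℝ} (hc : -1 ≤ c) (hc' : c ≤ 1) :
    -0.3 < (1 + c) * (1 - c ^ 2) * c * (2 + c) / 8 := by
  rcases le_total 0 c with h | h
  · have : 0 ≤ (1 + c) * (1 - c ^ 2) * c * (2 + c) := by
      have : 0 ≤ 1 - c ^ 2 := by nlinarith
      positivity
    linarith
  · have h1 : (0 : ℝ) ≤ 1 - c ^ 2 := by nlinarith
    have h2 : (1 + c) * (1 - c ^ 2) ≤ 1 := by nlinarith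
    have h3 : 0 ≤ (1 + c) * (1 - c ^ 2) := mul_nonneg (by linarith) h1
    nlinarith [mul_nonneg h3 (sq_nonneg (c + 1))]

lemma energyDensity_lt (γ β : ℝ) : energyDensity γ β < 0.9395 := by
  rw [energyDensity_eq]
  have h1 := Real.sin_sq_add_cos_sq γ
  have h2 := Real.sin_sq_add_cos_sq (4 * β)
  have hc := Real.neg_one_le_cos γ
  have hc' := Real.cos_le_one γ
  have hP := discriminant_lt (Real.cos γ)
  have hB := neg_lt_curvature hc hc'
  set s := Real.sin γ
  set c := Real.cos γ
  set p := Real.sin (4 * β)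
  set q := Real.cos (4 * β)
  set B := (1 + c) * (1 - c ^ 2) * c * (2 + c) / 8 with hBdef
  have hA : (s * c * (2 + 3 * c) / 8) ^ 2 < 0.1895 ^ 2 + 0.1895 * B := by
    refine lt_of_eq_of_lt ?_ hP
    rw [← h1]; ring
  set A := s * c * (2 + 3 * c) / 8
  -- Cauchy-Schwarz for the trigonometric polynomial in `4β`.
  have hCS : (A * p + B / 2 * q) ^ 2 ≤ A ^ 2 + (B / 2) ^ 2 := by
    have : A ^ 2 + (B / 2) ^ 2 = (A ^ 2 + (B / 2) ^ 2) * (p ^ 2 + q ^ 2) := by rw [h2, mul_one]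
    rw [this]
    nlinarith [sq_nonneg (A * q - B / 2 * p)]
  have hlt : A * p + B / 2 * q < 0.1895 + B / 2 := by
    refine lt_of_pow_lt_pow_left₀ 2 (by linarith) ?_
    nlinarith
  have : (1 + c) * (1 - c ^ 2) * c * (2 + c) / 16 = B / 2 := by rw [hBdef]; ring
  rw [this]
  linarith

lemma exists_lt_energyDensity : ∃ γ β : ℝ, 0.939 < energyDensity γ β := by
  -- Two Pythagorean triples close to the maximum.
  refine ⟨Real.arccos (153 / 185), Real.arccos (57 / 185) / 4, ?_⟩
  have e : 4 * (Real.arccos (57 / 185) / 4) = Real.arccos (57 / 185) := by ring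
  rw [energyDensity_eq, e, Real.cos_arccos (by norm_num) (by norm_num),
    Real.cos_arccos (by norm_num) (by norm_num), Real.sin_arccos, Real.sin_arccos,
    show (1 - (153 / 185 : ℝ) ^ 2) = (104 / 185) ^ 2 by norm_num,
    show (1 - (57 / 185 : ℝ) ^ 2) = (176 / 185) ^ 2 by norm_num,
    Real.sqrt_sq (by norm_num), Real.sqrt_sq (by norm_num)]
  norm_num

lemma continuous_energyDensity : Continuous fun p : ℝ × ℝ => energyDensity p.1 p.2 := by
  unfold energyDensity
  fun_prop

lemma exists_mem_Ico_energyDensity_eq (γ β : ℝ) :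
    ∃ γ' ∈ Set.Ico 0 (2 * Real.pi), ∃ β' ∈ Set.Ico 0 Real.pi,
      energyDensity γ' β' = energyDensity γ β := by
  have h2pi := Real.two_pi_pos
  have hpi := Real.pi_pos
  refine ⟨toIcoMod h2pi 0 γ, by simpa using toIcoMod_mem_Ico h2pi 0 γ,
    toIcoMod hpi 0 β, by simpa using toIcoMod_mem_Ico hpi 0 β, ?_⟩
  have hγ := self_sub_toIcoDiv_zsmul h2pi 0 γ
  have hβ := self_sub_toIcoDiv_zsmul hpi 0 β
  have e : 4 * toIcoMod hpi 0 β = 4 * β - ((2 * toIcoDiv hpi 0 β : ℤ) : ℝ) * (2 * Real.pi) := by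
    rw [← hβ, zsmul_eq_mul]; push_cast; ring
  rw [energyDensity_eq, energyDensity_eq, e, ← hγ, zsmul_eq_mul, Real.sin_sub_int_mul_two_pi,
    Real.cos_sub_int_mul_two_pi, Real.sin_sub_int_mul_two_pi, Real.cos_sub_int_mul_two_pi]

lemma exists_isMax_energyDensity :
    ∃ γ ∈ Set.Ico 0 (2 * Real.pi), ∃ β ∈ Set.Ico 0 Real.pi,
      ∀ γ' β', energyDensity γ' β' ≤ energyDensity γ β := by
  have hK : IsCompact (Set.Icc 0 (2 * Real.pi) ×ˢ Set.Icc 0 Real.pi) :=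
    isCompact_Icc.prod isCompact_Icc
  have hne : (Set.Icc 0 (2 * Real.pi) ×ˢ Set.Icc 0 Real.pi).Nonempty :=
    (Set.nonempty_Icc.mpr Real.two_pi_pos.le).prod (Set.nonempty_Icc.mpr Real.pi_pos.le)
  obtain ⟨⟨γ₀, β₀⟩, -, hmax⟩ := hK.exists_isMaxOn hne continuous_energyDensity.continuousOn
  obtain ⟨γ, hγ, β, hβ, heq⟩ := exists_mem_Ico_energyDensity_eq γ₀ β₀
  refine ⟨γ, hγ, β, hβ, fun γ' β' => ?_⟩
  obtain ⟨γ₁, hγ₁, β₁, hβ₁, heq₁⟩ := exists_mem_Ico_energyDensity_eq γ' β'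
  rw [heq, ← heq₁]
  exact isMaxOn_iff.mp hmax (γ₁, β₁) (Set.mk_mem_prod
    (Set.Ico_subset_Icc_self hγ₁) (Set.Ico_subset_Icc_self hβ₁))

/-! ### Windows in 2-regular graphs of large girth -/

section Windows

variable {V : Type*} {G : SimpleGraph V}

/-- Extending a path by an edge without turning back gives a path again, as long as the result is
shorter than the girth. -/
lemma isPath_cons_of_lt_egirth {a b c d : V} (h : G.Adj a b) (h' : G.Adj b c) {p : G.Walk c d}
    (hp : (SimpleGraph.Walk.cons h' p).IsPath) (hac : a ≠ c)
    (hlen : ((p.length + 2 : ℕ) : ℕ∞) < G.egirth) :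
    (SimpleGraph.Walk.cons h (.cons h' p)).IsPath := by
  classical
  refine (SimpleGraph.Walk.cons_isPath_iff _ _).mpr ⟨hp, fun hmem => ?_⟩
  set q := (SimpleGraph.Walk.cons h' p).takeUntil a hmem
  have hq : (SimpleGraph.Walk.cons h q).IsCycle := by
    refine (SimpleGraph.Walk.cons_isCycle_iff _ _).mpr ⟨hp.takeUntil hmem, fun he => ?_⟩
    have he' := SimpleGraph.Walk.edges_takeUntil_subset_edges _ hmem he
    rw [SimpleGraph.Walk.edges_cons, List.mem_cons] at he'
    rcases he' with he' | he'
    · rcases Sym2.eq_iff.mp he' with ⟨hab, -⟩ | ⟨hac', -⟩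
      · exact h.ne hab
      · exact hac hac'
    · exact ((SimpleGraph.Walk.cons_isPath_iff _ _).mp hp).2
        (p.snd_mem_support_of_mem_edges he')
  refine absurd (SimpleGraph.le_egirth.mp le_rfl _ _ hq) (not_le.mpr (lt_of_le_of_lt ?_ hlen))
  have := SimpleGraph.Walk.length_takeUntil_le_length (SimpleGraph.Walk.cons h' p) hmem
  rw [SimpleGraph.Walk.length_cons] at this ⊢
  exact_mod_cast Nat.succ_le_succ this

variable [Fintype V] [DecidableEq V] [DecidableRel G.Adj]

lemma exists_other_neighbor (hreg : G.IsRegularOfDegree 2) {v u : V} (h : G.Adj v u) :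
    ∃ w, u ≠ w ∧ G.neighborFinset v = {u, w} := by
  have h2 : (G.neighborFinset v).card = 2 := hreg v
  obtain ⟨x, y, hxy, hN⟩ := Finset.card_eq_two.mp h2
  have hu : u ∈ G.neighborFinset v := by simpa using h
  rw [hN, Finset.mem_insert, Finset.mem_singleton] at hu
  rcases hu with rfl | rfl
  · exact ⟨y, hxy, hN⟩
  · exact ⟨x, hxy.symm, by rw [hN, Finset.pair_comm]⟩

/-- Around an edge of a 2-regular graph of girth at least 7, the graph looks like a path of seven
distinct vertices. -/
lemma exists_window (hreg : G.IsRegularOfDegree 2) (hg : 7 ≤ G.egirth) {p₂ p₃ : V}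
    (h : G.Adj p₂ p₃) :
    ∃ p₀ p₁ p₄ p₅ p₆ : V, [p₀, p₁, p₂, p₃, p₄, p₅, p₆].Nodup ∧
      G.neighborFinset p₁ = {p₀, p₂} ∧ G.neighborFinset p₂ = {p₁, p₃} ∧
      G.neighborFinset p₃ = {p₂, p₄} ∧ G.neighborFinset p₄ = {p₃, p₅} ∧
      G.neighborFinset p₅ = {p₄, p₆} := by
  have adj : ∀ {v x y : V}, G.neighborFinset v = {x, y} → G.Adj v y := by
    intro v x y hv
    rw [← SimpleGraph.mem_neighborFinset, hv]
    simp
  obtain ⟨p₁, n31, N2⟩ := exists_other_neighbor hreg h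
  have a21 := adj N2
  obtain ⟨p₀, n20, N1⟩ := exists_other_neighbor hreg a21.symm
  have a10 := adj N1
  obtain ⟨p₄, n24, N3⟩ := exists_other_neighbor hreg h.symm
  have a34 := adj N3
  obtain ⟨p₅, n35, N4⟩ := exists_other_neighbor hreg a34.symm
  have a45 := adj N4
  obtain ⟨p₆, n46, N5⟩ := exists_other_neighbor hreg a45.symm
  have a56 := adj N5
  refine ⟨p₀, p₁, p₄, p₅, p₆, ?_, by rw [N1, Finset.pair_comm], by rw [N2, Finset.pair_comm],
    N3, N4, N5⟩
  have hlt : ∀ k : ℕ, k < 7 → (k : ℕ∞) < G.egirth := fun k hk =>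
    lt_of_lt_of_le (by exact_mod_cast hk) hg
  have P5 : (SimpleGraph.Walk.cons a56 .nil).IsPath := by simpa using a56.ne
  have P4 := isPath_cons_of_lt_egirth a45 a56 P5 n46 (hlt _ (by simp))
  have P3 := isPath_cons_of_lt_egirth a34 a45 P4 n35 (hlt _ (by simp))
  have P2 := isPath_cons_of_lt_egirth h a34 P3 n24 (hlt _ (by simp))
  have P1 := isPath_cons_of_lt_egirth a21.symm h P2 n31.symm (hlt _ (by simp))
  have P0 := isPath_cons_of_lt_egirth a10.symm a21.symm P1 n20.symm (hlt _ (by simp))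
  simpa only [SimpleGraph.Walk.support_cons, SimpleGraph.Walk.support_nil] using P0.support_nodup

end Windows

/-! ### The couplings of the LocalMaxCut Hamiltonian -/

section Couplings

variable {V : Type*} [Fintype V] [DecidableEq V] (G : SimpleGraph V) [DecidableRel G.Adj]

/-- The Ising couplings of the LocalMaxCut Hamiltonian: `1/2` for each edge, which occurs in the
local terms at both of its ends, and `1/4` for each common neighbour. -/
noncomputable def coupling (u w : V) : ℝ :=
  if u = w then 0 else
    ((if G.Adj u w then 1 / 2 else 0)
      + 1 / 4 * ∑ v, if G.Adj v u ∧ G.Adj v w then 1 else 0)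

lemma coupling_symm (u w : V) : coupling G u w = coupling G w u := by
  simp only [coupling, eq_comm (a := u) (b := w), G.adj_comm u w,
    and_comm (a := G.Adj _ u) (b := G.Adj _ w)]

lemma coupling_self (u : V) : coupling G u u = 0 := by simp [coupling]

variable {G}

lemma localTerm_eq_diagonal (v : V) :
    localTerm G v = Matrix.diagonal fun x => ((3 / 4
      - 1 / 4 * ∑ u ∈ G.neighborFinset v, spin (x v) * spin (x u)
      - 1 / 4 * ∏ u ∈ G.neighborFinset v, spin (x u) : ℝ) : ℂ) := by
  have h1 : ∀ u ∈ G.neighborFinset v, (onQubits pauliZ {v, u} : Operator V)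
      = Matrix.diagonal fun x => ((spin (x v) * spin (x u) : ℝ) : ℂ) := by
    intro u hu
    have hne : v ≠ u := ((G.mem_neighborFinset v u).mp hu).ne
    simp only [onQubits_pauliZ, Finset.prod_pair hne]
  rw [localTerm, Finset.sum_congr rfl h1, onQubits_pauliZ]
  ext x y
  by_cases hxy : x = y
  · subst hxy
    simp [Matrix.sum_apply]
  · simp [Matrix.sum_apply, hxy]

/-- Over the ordered pairs of distinct neighbours of `v`, the product of the two spins is counted
twice. -/
lemma prod_neighbor_spin (hreg : G.IsRegularOfDegree 2) (v : V) (x : V → Fin 2) :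
    ∏ u ∈ G.neighborFinset v, spin (x u)
      = 1 / 2 * ∑ u, ∑ w, if u = w then 0 else
        (if G.Adj v u ∧ G.Adj v w then 1 else 0) * (spin (x u) * spin (x w)) := by
  obtain ⟨a, b, hab, hN⟩ := Finset.card_eq_two.mp (hreg v)
  have hadj : ∀ u, G.Adj v u ↔ u ∈ ({a, b} : Finset V) := fun u => by
    rw [← hN, SimpleGraph.mem_neighborFinset]
  have h1 : ∑ u, ∑ w, (if u = w then 0 else
        (if G.Adj v u ∧ G.Adj v w then 1 else 0) * (spin (x u) * spin (x w)))
      = ∑ u ∈ {a, b}, ∑ w ∈ {a, b}, if u = w then 0 else spin (x u) * spin (x w) := by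
    rw [← Finset.sum_subset (Finset.subset_univ {a, b})]
    · refine Finset.sum_congr rfl fun u hu => ?_
      rw [← Finset.sum_subset (Finset.subset_univ {a, b})]
      · refine Finset.sum_congr rfl fun w hw => ?_
        simp only [hadj, hu, hw, and_self, if_true, one_mul]
      · intro w _ hw
        simp only [hadj, hw, and_false, if_false, zero_mul, ite_self]
    · intro u _ hu
      simp only [hadj, hu, false_and, if_false, zero_mul, ite_self, Finset.sum_const_zero]
  rw [h1, hN, Finset.prod_pair hab, Finset.sum_pair hab, Finset.sum_pair hab, Finset.sum_pair hab]
  simp only [hab, hab.symm, if_true, if_false]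
  ring

lemma hamiltonian_eq_diagonal (hreg : G.IsRegularOfDegree 2) :
    hamiltonian G = Matrix.diagonal fun x =>
      (isingEnergy (3 * (Fintype.card V : ℝ) / 4) (coupling G) x : ℂ) := by
  have hE : ∀ x : V → Fin 2, isingEnergy (3 * (Fintype.card V : ℝ) / 4) (coupling G) x
      = ∑ v, (3 / 4 - 1 / 4 * ∑ u ∈ G.neighborFinset v, spin (x v) * spin (x u)
        - 1 / 4 * ∏ u ∈ G.neighborFinset v, spin (x u)) := by
    intro x
    have h1 : ∀ u w, coupling G u w * (spin (x u) * spin (x w))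
        = 1 / 2 * (if G.Adj u w then spin (x u) * spin (x w) else 0)
          + 1 / 4 * ∑ v, if u = w then 0 else
            (if G.Adj v u ∧ G.Adj v w then 1 else 0) * (spin (x u) * spin (x w)) := by
      intro u w
      by_cases h : u = w
      · subst h; simp [coupling]
      · simp only [coupling, h, if_false, ← Finset.sum_mul]
        split_ifs <;> ring
    have h2 : ∑ v, ∏ u ∈ G.neighborFinset v, spin (x u)
        = 1 / 2 * ∑ u, ∑ w, ∑ v, if u = w then 0 else
            (if G.Adj v u ∧ G.Adj v w then 1 else 0) * (spin (x u) * spin (x w)) := by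
      rw [Finset.sum_congr rfl fun v _ => prod_neighbor_spin hreg v x, ← Finset.mul_sum,
        Finset.sum_comm]
      congr 1
      exact Finset.sum_congr rfl fun u _ => Finset.sum_comm
    have h3 : ∀ v, ∑ u ∈ G.neighborFinset v, spin (x v) * spin (x u)
        = ∑ u, if G.Adj v u then spin (x v) * spin (x u) else 0 := by
      intro v
      rw [← Finset.sum_filter]
      congr 1
      ext u
      simp
    simp only [isingEnergy, h1, Finset.sum_add_distrib, Finset.sum_sub_distrib, ← Finset.mul_sum,
      h2, h3, Finset.sum_const, Finset.card_univ, nsmul_eq_mul]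
    ring
  simp only [hamiltonian, localTerm_eq_diagonal, hE]
  ext x y
  by_cases hxy : x = y
  · subst hxy
    simp [Matrix.sum_apply]
  · simp [Matrix.sum_apply, hxy]

/-- A vertex interacts with the four vertices at distance 1 and 2 only. -/
lemma coupling_eq_of_neighbors {l₂ l₁ a r₁ r₂ : V} (hnodup : [l₂, l₁, a, r₁, r₂].Nodup)
    (hl : G.neighborFinset l₁ = {l₂, a}) (ha : G.neighborFinset a = {l₁, r₁})
    (hr : G.neighborFinset r₁ = {a, r₂}) (u : V) :
    coupling G a u = (if u = l₁ ∨ u = r₁ then 1 / 2 else 0)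
      + if u = l₂ ∨ u = r₂ then 1 / 4 else 0 := by
  have adj : ∀ {v x y : V}, G.neighborFinset v = {x, y} → ∀ w, G.Adj v w ↔ w = x ∨ w = y := by
    intro v x y hv w
    rw [← SimpleGraph.mem_neighborFinset, hv]
    simp
  simp only [List.nodup_cons, List.mem_cons, List.not_mem_nil, or_false, not_or] at hnodup
  obtain ⟨⟨n1, n2, n3, n4⟩, ⟨n5, n6, n7⟩, ⟨n8, n9⟩, n10, -⟩ := hnodup
  by_cases hau : a = u
  · subst hau
    simp [coupling, Ne.symm n2, Ne.symm n5, n8, n9]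
  · have hsum : ∑ v, (if G.Adj v a ∧ G.Adj v u then (1 : ℝ) else 0)
        = (if G.Adj l₁ u then 1 else 0) + if G.Adj r₁ u then 1 else 0 := by
      have h1 : ∀ v, (if G.Adj v a ∧ G.Adj v u then (1 : ℝ) else 0)
          = if v ∈ ({l₁, r₁} : Finset V) then if G.Adj v u then 1 else 0 else 0 := by
        intro v
        simp only [← ha, SimpleGraph.mem_neighborFinset, G.adj_comm a v, ite_and]
      simp_rw [h1, Finset.sum_ite_mem, Finset.univ_inter]
      exact Finset.sum_pair n6
    simp only [coupling, hau, if_false, hsum, adj hl, adj hr, adj ha, Ne.symm hau, or_false,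
      false_or]
    by_cases e1 : u = l₂
    · subst e1; simp [n1, n3, n4]
    · by_cases e2 : u = r₂
      · subst e2; simp [e1, Ne.symm n7, Ne.symm n10]
      · simp [e1, e2]

lemma prod_compl_eq_prod {K s : Finset V} (hs : Disjoint s K) {f : V → ℝ}
    (h : ∀ u ∉ s, u ∉ K → f u = 1) : ∏ u ∈ Kᶜ, f u = ∏ u ∈ s, f u := by
  symm
  refine Finset.prod_subset (fun u hu => ?_) fun u hu hu' => h u hu' (Finset.mem_compl.mp hu)
  exact Finset.mem_compl.mpr (Finset.disjoint_left.mp hs hu)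

/-! ### The correlations at distance 1 and 2 -/

/-- The correlation along an edge. The cosine products in `expectation_pauliZ_pair` are over the
window only: outside of it all couplings vanish. -/
lemma expectation_edge (hreg : G.IsRegularOfDegree 2) (hg : 7 ≤ G.egirth) {a b : V}
    (h : G.Adj a b) (γ β : ℝ) :
    expectation (onQubits pauliZ {a, b}) (qaoaState (hamiltonian G) γ β)
      = ((-(2 * Real.sin (2 * β) * Real.cos (2 * β) * Real.sin γ
          * (Real.cos γ * Real.cos (γ / 2) ^ 2))
        - Real.sin (2 * β) ^ 2 / 2
          * (Real.cos (γ / 2) ^ 2 * Real.cos (3 * γ / 2) ^ 2 - Real.cos (γ / 2) ^ 4) : ℝ) : ℂ) := by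
  obtain ⟨p₀, p₁, p₄, p₅, p₆, hnodup, N1, N2, N3, N4, N5⟩ := exists_window hreg hg h
  have Ja := coupling_eq_of_neighbors (hnodup.sublist (by simp)) N1 N2 N3
  have Jb := coupling_eq_of_neighbors (l₂ := p₁) (hnodup.sublist (by simp)) N2 N3 N4
  simp only [List.nodup_cons, List.mem_cons, List.not_mem_nil, or_false, not_or] at hnodup
  obtain ⟨⟨n01, n02, n03, n04, n05, -⟩, ⟨n12, n13, n14, n15, -⟩, ⟨n23, n24, n25, -⟩,
    ⟨n34, n35, -⟩, ⟨n45, -⟩, -⟩ := hnodup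
  have hs : Disjoint ({p₀, p₁, p₄, p₅} : Finset V) {a, b} := by
    simp [Ne.symm n02, Ne.symm n03, Ne.symm n12, Ne.symm n13, n24, n25, n34, n35]
  have hJ : ∀ u ∉ ({p₀, p₁, p₄, p₅} : Finset V), u ∉ ({a, b} : Finset V) →
      coupling G a u = 0 ∧ coupling G b u = 0 := by
    intro u hu hu'
    simp only [Finset.mem_insert, Finset.mem_singleton, not_or] at hu hu'
    simp [Ja, Jb, hu, hu']
  have hprod : ∀ F : ℝ → ℝ → ℝ, F 0 0 = 1 →
      ∏ u ∈ ({a, b} : Finset V)ᶜ, F (coupling G a u) (coupling G b u)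
        = F (1 / 4) 0 * (F (1 / 2) (1 / 4) * (F (1 / 4) (1 / 2) * F 0 (1 / 4))) := by
    intro F hF
    rw [prod_compl_eq_prod hs fun u hu hu' => by rw [(hJ u hu hu').1, (hJ u hu hu').2, hF],
      Finset.prod_insert (by simp [n01, n04, n05]), Finset.prod_insert (by simp [n14, n15]),
      Finset.prod_pair n45]
    simp only [Ja, Jb]
    simp [n01, n02, n03, n04, n05, n12, n13, n14, n15, Ne.symm n01, Ne.symm n04, Ne.symm n05,
      Ne.symm n14, Ne.symm n15, Ne.symm n24, Ne.symm n25, Ne.symm n34, Ne.symm n35, n45,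
      Ne.symm n45]
  have hab : coupling G a b = 1 / 2 := by simp [Ja, n34, Ne.symm n03]
  rw [hamiltonian_eq_diagonal hreg,
    expectation_pauliZ_pair (coupling_symm G) (coupling_self G) h.ne,
    hprod (fun s _ => Real.cos (2 * γ * s)) (by simp),
    hprod (fun _ t => Real.cos (2 * γ * t)) (by simp),
    hprod (fun s t => Real.cos (2 * γ * (s + t))) (by simp),
    hprod (fun s t => Real.cos (2 * γ * (s - t))) (by simp), hab]
  simp only [add_zero, zero_add, sub_zero, zero_sub, mul_zero, mul_neg, Real.cos_neg,
    Real.cos_zero, show 2 * γ * (1 / 4) = γ / 2 by ring, show 2 * γ * (1 / 2) = γ by ring,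
    show 2 * γ * (1 / 2 + 1 / 4) = 3 * γ / 2 by ring,
    show 2 * γ * (1 / 4 + 1 / 2) = 3 * γ / 2 by ring,
    show 2 * γ * (1 / 2 - 1 / 4) = γ / 2 by ring,
    show 2 * γ * (1 / 4 - 1 / 2) = -(γ / 2) by ring]
  congr 1
  ring

/-- The correlation between the two neighbours of a vertex. -/
lemma expectation_neighborFinset (hreg : G.IsRegularOfDegree 2) (hg : 7 ≤ G.egirth) (v : V)
    (γ β : ℝ) :
    expectation (onQubits pauliZ (G.neighborFinset v)) (qaoaState (hamiltonian G) γ β)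
      = ((-(2 * Real.sin (2 * β) * Real.cos (2 * β) * Real.sin (γ / 2)
          * (Real.cos (γ / 2) * Real.cos γ ^ 2))
        - Real.sin (2 * β) ^ 2 / 2
          * (Real.cos (γ / 2) ^ 2 * Real.cos γ ^ 2 * (Real.cos (2 * γ) - 1)) : ℝ) : ℂ) := by
  obtain ⟨a, c, -, hac⟩ := Finset.card_eq_two.mp (hreg v)
  have h : G.Adj a v := by
    rw [G.adj_comm, ← SimpleGraph.mem_neighborFinset, hac]
    simp
  obtain ⟨p₀, p₁, b, p₅, p₆, hnodup, N1, N2, N3, N4, N5⟩ := exists_window hreg hg h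
  have Ja := coupling_eq_of_neighbors (hnodup.sublist (by simp)) N1 N2 N3
  have Jb := coupling_eq_of_neighbors (l₂ := a) (hnodup.sublist (by simp)) N3 N4 N5
  rw [N3]
  simp only [List.nodup_cons, List.mem_cons, List.not_mem_nil, or_false, not_or] at hnodup
  obtain ⟨⟨n01, n02, n03, n04, n05, n06⟩, ⟨n12, n13, n14, n15, n16⟩, ⟨n23, n24, n25, n26⟩,
    ⟨n34, n35, n36⟩, ⟨n45, n46⟩, n56, -⟩ := hnodup
  have hs : Disjoint ({p₀, p₁, v, p₅, p₆} : Finset V) {a, b} := by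
    simp [Ne.symm n02, Ne.symm n04, Ne.symm n12, Ne.symm n14, n23, Ne.symm n34, n25, n45, n26,
      n46]
  have hJ : ∀ u ∉ ({p₀, p₁, v, p₅, p₆} : Finset V), u ∉ ({a, b} : Finset V) →
      coupling G a u = 0 ∧ coupling G b u = 0 := by
    intro u hu hu'
    simp only [Finset.mem_insert, Finset.mem_singleton, not_or] at hu hu'
    simp [Ja, Jb, hu, hu']
  have hprod : ∀ F : ℝ → ℝ → ℝ, F 0 0 = 1 →
      ∏ u ∈ ({a, b} : Finset V)ᶜ, F (coupling G a u) (coupling G b u)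
        = F (1 / 4) 0 * (F (1 / 2) 0 * (F (1 / 2) (1 / 2) * (F 0 (1 / 2) * F 0 (1 / 4)))) := by
    intro F hF
    rw [prod_compl_eq_prod hs fun u hu hu' => by rw [(hJ u hu hu').1, (hJ u hu hu').2, hF],
      Finset.prod_insert (by simp [n01, n03, n05, n06]),
      Finset.prod_insert (by simp [n13, n15, n16]), Finset.prod_insert (by simp [n35, n36]),
      Finset.prod_pair n56]
    simp only [Ja, Jb]
    simp [n01, n02, n03, n04, n05, n06, n12, n13, n14, n15, n16, Ne.symm n01, Ne.symm n03,
      Ne.symm n05, Ne.symm n06, Ne.symm n13, Ne.symm n15, Ne.symm n16, Ne.symm n23, n34, n35, n36,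
      Ne.symm n25, Ne.symm n26, Ne.symm n35, Ne.symm n36, Ne.symm n45, Ne.symm n46, n56,
      Ne.symm n56]
  have hab : coupling G a b = 1 / 4 := by simp [Ja, Ne.symm n14, Ne.symm n34]
  rw [hamiltonian_eq_diagonal hreg,
    expectation_pauliZ_pair (coupling_symm G) (coupling_self G) n24,
    hprod (fun s _ => Real.cos (2 * γ * s)) (by simp),
    hprod (fun _ t => Real.cos (2 * γ * t)) (by simp),
    hprod (fun s t => Real.cos (2 * γ * (s + t))) (by simp),
    hprod (fun s t => Real.cos (2 * γ * (s - t))) (by simp), hab]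
  simp only [add_zero, zero_add, sub_zero, zero_sub, sub_self, mul_zero, mul_neg, Real.cos_neg,
    Real.cos_zero, show 2 * γ * (1 / 4) = γ / 2 by ring, show 2 * γ * (1 / 2) = γ by ring,
    show 2 * γ * (1 / 2 + 1 / 2) = 2 * γ by ring]
  congr 1
  ring

lemma expectation_sub (A B : Operator V) (ψ : QState V) :
    expectation (A - B) ψ = expectation A ψ - expectation B ψ := by
  simp [expectation, Matrix.sub_mulVec, dotProduct_sub]

lemma expectation_smul (c : ℂ) (A : Operator V) (ψ : QState V) :
    expectation (c • A) ψ = c * expectation A ψ := by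
  simp [expectation, Matrix.smul_mulVec]

lemma expectation_sum {ι : Type*} (s : Finset ι) (A : ι → Operator V) (ψ : QState V) :
    expectation (∑ i ∈ s, A i) ψ = ∑ i ∈ s, expectation (A i) ψ := by
  simp [expectation, Matrix.sum_mulVec, dotProduct_sum]

end Couplings

/-! ### The expectation value -/

section Normalization

variable {V : Type*} [Fintype V] [DecidableEq V]

lemma gate_neg_mul_gate (A : Operator V) (θ : ℝ) : gate A (-θ) * gate A θ = 1 := by
  rw [gate, gate, ← Matrix.exp_add_of_commute _ _ (((Commute.refl A).smul_left _).smul_right _),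
    ← add_smul]
  simp

lemma expectation_one_qaoaState {H : Operator V} (hH : H.IsHermitian) (γ β : ℝ) :
    expectation 1 (qaoaState H γ β) = 1 := by
  have h1 : ∀ (A : Operator V) (θ : ℝ) (φ : QState V), A.IsHermitian →
      expectation 1 (gate A θ *ᵥ φ) = expectation 1 φ := by
    intro A θ φ hA
    rw [expectation_gate_mulVec _ _ hA, mul_one, gate_neg_mul_gate, expectation]
  rw [qaoaState, h1 _ _ _ mixer_isHermitian, h1 _ _ _ hH, expectation, Matrix.one_mulVec]
  simp only [dotProduct, Pi.star_apply, star_uniformState_mul_self]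
  simp

lemma F_eq {G : SimpleGraph V} [DecidableRel G.Adj] (hreg : G.IsRegularOfDegree 2)
    (hg : 7 ≤ G.egirth) (γ β : ℝ) :
    F G γ β = (((Fintype.card V : ℝ) * energyDensity γ β : ℝ) : ℂ) := by
  have hherm : (hamiltonian G).IsHermitian := by
    rw [hamiltonian_eq_diagonal hreg, Matrix.isHermitian_diagonal_iff]
    intro x
    simp [isSelfAdjoint_iff]
  have hv : ∀ v, expectation (localTerm G v) (qaoaState (hamiltonian G) γ β)
      = (energyDensity γ β : ℂ) := by
    intro v
    rw [localTerm, expectation_sub, expectation_sub, expectation_smul, expectation_smul,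
      expectation_smul, expectation_sum, expectation_one_qaoaState hherm,
      expectation_neighborFinset hreg hg,
      Finset.sum_congr rfl fun u hu =>
        expectation_edge hreg hg ((G.mem_neighborFinset v u).mp hu) γ β,
      Finset.sum_const, SimpleGraph.card_neighborFinset_eq_degree, hreg v]
    rw [energyDensity_eq_sub_correlations, nsmul_eq_mul]
    push_cast
    ring
  have hsum : ∀ ψ, expectation (hamiltonian G) ψ = ∑ v, expectation (localTerm G v) ψ := by
    intro ψ
    rw [hamiltonian, expectation_sum]
  rw [F, hsum, Finset.sum_congr rfl fun v _ => hv v, Finset.sum_const, nsmul_eq_mul,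
    Finset.card_univ]
  push_cast
  rfl

end Normalization

end LocalMaxCutQAOA

theorem theorem5 {V : Type*} [Fintype V] [DecidableEq V] [Nonempty V]
    (G : SimpleGraph V) [DecidableRel G.Adj]
    (hreg : G.IsRegularOfDegree 2) (hgirth : 7 ≤ G.egirth) :
    (∀ γ β : ℝ, LocalMaxCutQAOA.F G γ β =
      ((3 * (Fintype.card V : ℝ) / 4
        + (Fintype.card V : ℝ) / 32 * Real.sin (4 * β)
          * (3 * Real.sin γ + 4 * Real.sin (2 * γ) + 3 * Real.sin (3 * γ))
        - (Fintype.card V : ℝ) / 16 * Real.sin (2 * β) ^ 2 * Real.sin γ * Real.cos (γ / 2) ^ 2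
          * (Real.sin γ + 4 * Real.sin (2 * γ) + Real.sin (3 * γ)) : ℝ) : ℂ)) ∧
    (∀ γ β : ℝ, (LocalMaxCutQAOA.F G γ β).re < 0.94 * (Fintype.card V : ℝ)) ∧
    (∃ M : ℝ, 0.939 < M ∧ M < 0.9395 ∧
      (∃ γ ∈ Set.Ico 0 (2 * Real.pi), ∃ β ∈ Set.Ico 0 Real.pi,
        (LocalMaxCutQAOA.F G γ β).re = M * (Fintype.card V : ℝ)) ∧
      ∀ γ β : ℝ, (LocalMaxCutQAOA.F G γ β).re ≤ M * (Fintype.card V : ℝ)) := by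
  have hn : (0 : ℝ) < Fintype.card V := by exact_mod_cast Fintype.card_pos
  have hF : ∀ γ β : ℝ, (LocalMaxCutQAOA.F G γ β).re
      = LocalMaxCutQAOA.energyDensity γ β * (Fintype.card V : ℝ) := fun γ β => by
    rw [LocalMaxCutQAOA.F_eq hreg hgirth, Complex.ofReal_re, mul_comm]
  refine ⟨fun γ β => ?_, fun γ β => ?_, ?_⟩
  · rw [LocalMaxCutQAOA.F_eq hreg hgirth, LocalMaxCutQAOA.energyDensity]
    congr 1
    ring
  · rw [hF]
    exact mul_lt_mul_of_pos_right
      ((LocalMaxCutQAOA.energyDensity_lt γ β).trans (by norm_num)) hn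
  · obtain ⟨γ, hγ, β, hβ, hmax⟩ := LocalMaxCutQAOA.exists_isMax_energyDensity
    obtain ⟨γ₀, β₀, h₀⟩ := LocalMaxCutQAOA.exists_lt_energyDensity
    refine ⟨LocalMaxCutQAOA.energyDensity γ β, h₀.trans_le (hmax γ₀ β₀),
      LocalMaxCutQAOA.energyDensity_lt γ β, ⟨γ, hγ, β, hβ, hF γ β⟩, fun γ' β' => ?_⟩
    rw [hF]
    exact mul_le_mul_of_nonneg_right (hmax γ' β') hn.le
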